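/- **Setting.** Let $(X,\Sigma)$ be a measurable space, $\Sigma$ a $\sigma$-algebra, and let $p(x,E)$ ($x\in X$, $E\in\Sigma$) be the transition function of a Markov chain: $p(x,\cdot)$ is a countably additive probability measure for every $x$, and $p(\cdot,E)$ is $\Sigma$-measurable for every $E\in\Sigma$. Let $ba(X,\Sigma)$ be the space of all bounded finitely additive measures $\mu\colon\Sigma\to\mathbb R$, ordered by $\mu\le\nu$ iff $\mu(E)\le\nu(E)$ for all $E\in\Sigma$. It is a vector lattice with $(\mu\wedge\nu)(E)=\inf\{\mu(E\cap C)+\nu(E\setminus C): C\in\Sigma\}$ and $\mu\vee\nu=-((-\mu)\wedge(-\nu))$. The Markov operator $A\colon ba(X,\Sigma)\to ba(X,\Sigma)$ is $(A\mu)(E)=\int_X p(x,E)\,\mu(dx)$ (the integral of a bounded measurable function being the limit of the integrals of simple functions converging uniformly to it), and $M_{ba}=\{\mu\in ba(X,\Sigma): A\mu=\mu\}$ is the linear space of invariant measures. A measure $\mu\ge 0$ in $ba(X,\Sigma)$ is purely finitely additive if the only countably additive $\lambda$ with $0\le\lambda\le\mu$ is $\lambda=0$. **Theorem 3.3.** Suppose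 that $\dim M_{ba}=m<\infty$. Then $M_{ba}$ is a vector sublattice of $ba(X,\Sigma)$, and it is algebraically and lattice-isomorphic to $\mathbb R^m$ with the coordinatewise order: there is a linear bijection $\Phi\colon M_{ba}\to\mathbb R^m$ such that $\mu\le\nu\iff\Phi(\mu)\le\Phi(\nu)$, $\Phi(\mu\vee\nu)=\Phi(\mu)\vee\Phi(\nu)$ and $\Phi(\mu\wedge\nu)=\Phi(\mu)\wedge\Phi(\nu)$. Moreover $M_{ba}$ has a linear basis $\mu_1,\dots,\mu_m$ such that 1. each $\mu_i$ is a finitely additive probability measure: $\mu_i\ge0$ and $\|\mu_i\|=\mu_i(X)=1$; 2. each $\mu_i$ is a discrete element of the vector lattice $M_{ba}$: there are no $\lambda,\nu\in M_{ba}$ with $\lambda>0$, $\nu>0$, $\lambda\wedge\nu=0$, $\lambda\le\mu_i$ and $\nu\le\mu_i$; 3. each $\mu_i$ is either countably additive or purely finitely additive; 4. the $\mu_i$ are pairwise disjoint: $\mu_i\wedge\mu_j=0$ for $i\ne j$. Every invariant measure $\mu\in M_{ba}$ has a unique representation $\mu=\sum_{i=1}^m\alpha_i\mu_i$ with $\alpha_1,\dots,\alpha_m\in\mathbb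 R$. -/

import Mathlib

noncomputable section

namespace FAMarkov

open MeasureTheory ProbabilityTheory

/-- The sigma-algebra `Σ` of a measurable space, as a type. -/
abbrev Meas (X : Type*) [MeasurableSpace X] : Type _ := {E : Set X // MeasurableSet E}

/-- The space `ba(X, Σ)` of bounded finitely additive (signed) measures on `Σ`, as a subspace of
the space of all set functions `Σ → ℝ`. Being a subtype of `Σ → ℝ`, it carries the setwise order:
`μ ≤ ν` means `μ(E) ≤ ν(E)` for all `E ∈ Σ`. -/
def ba (X : Type*) [MeasurableSpace X] : Submodule ℝ (Meas X → ℝ) where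
  carrier := {μ | μ ∅ = 0 ∧
    (∀ E F : Meas X, Disjoint (E : Set X) (F : Set X) → μ (E ∪ F) = μ E + μ F) ∧
    ∃ K : ℝ, ∀ E, |μ E| ≤ K}
  zero_mem' := ⟨rfl, fun _ _ _ => by simp, 0, fun _ => by simp⟩
  add_mem' := by
    rintro μ ν ⟨h0, ha, K, hK⟩ ⟨h0', ha', K', hK'⟩
    refine ⟨by simp [h0, h0'], fun E F h => ?_, K + K', fun E => ?_⟩
    · simp only [Pi.add_apply, ha E F h, ha' E F h]; ring
    · exact (abs_add_le _ _).trans (add_le_add (hK E) (hK' E))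
  smul_mem' := by
    rintro c μ ⟨h0, ha, K, hK⟩
    refine ⟨by simp [h0], fun E F h => ?_, |c| * K, fun E => ?_⟩
    · simp only [Pi.smul_apply, ha E F h, smul_add]
    · simp only [Pi.smul_apply, smul_eq_mul, abs_mul]
      exact mul_le_mul_of_nonneg_left (hK E) (abs_nonneg c)

variable {X : Type*} [MeasurableSpace X]

theorem ba_union (μ : ba X) (E F : Meas X) (h : Disjoint (E : Set X) (F : Set X)) :
    μ.1 (E ∪ F) = μ.1 E + μ.1 F := μ.2.2.1 E F h

theorem ba_inter_add_diff (μ : ba X) (E C : Meas X) :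
    μ.1 (E ∩ C) + μ.1 (E \ C) = μ.1 E := by
  rw [← ba_union μ (E ∩ C) (E \ C) Set.disjoint_sdiff_inter.symm]
  exact congrArg μ.1 (Subtype.ext (Set.inter_union_sdiff (E : Set X) (C : Set X)))

/-! ### The lattice structure of `ba(X, Σ)` -/

/-- `(μ ∧ ν)(E)` is the infimum over `C ∈ Σ` of `μ(E ∩ C) + ν(E \ C)`. -/
def infFun (μ ν : ba X) (E : Meas X) : ℝ := ⨅ C : Meas X, (μ.1 (E ∩ C) + ν.1 (E \ C))

theorem infFun_bddBelow (μ ν : ba X) (E : Meas X) :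
    BddBelow (Set.range fun C : Meas X => μ.1 (E ∩ C) + ν.1 (E \ C)) := by
  obtain ⟨K, hK⟩ := μ.2.2.2
  obtain ⟨L, hL⟩ := ν.2.2.2
  refine ⟨-(K + L), ?_⟩
  rintro _ ⟨C, rfl⟩
  have h1 := (abs_le.1 (hK (E ∩ C))).1
  have h2 := (abs_le.1 (hL (E \ C))).1
  simp only
  linarith

theorem infFun_le (μ ν : ba X) (E C : Meas X) : infFun μ ν E ≤ μ.1 (E ∩ C) + ν.1 (E \ C) :=
  ciInf_le (infFun_bddBelow μ ν E) C

theorem infFun_mem (μ ν : ba X) : infFun μ ν ∈ ba X := by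
  refine ⟨?_, fun E F h => le_antisymm ?_ ?_, ?_⟩
  · have h : ∀ C : Meas X, μ.1 (∅ ∩ C) + ν.1 (∅ \ C) = 0 := by
      intro C
      have h1 : (∅ : Meas X) ∩ C = ∅ := Subtype.ext (Set.empty_inter _)
      have h2 : (∅ : Meas X) \ C = ∅ := Subtype.ext (Set.empty_sdiff _)
      rw [h1, h2, μ.2.1, ν.2.1, add_zero]
    simp only [infFun, h, ciInf_const]
  · refine le_ciInf_add_ciInf fun C D => ?_
    refine (infFun_le μ ν (E ∪ F) ((E ∩ C) ∪ (F ∩ D))).trans (le_of_eq ?_)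
    have h1 : (E ∪ F) ∩ ((E ∩ C) ∪ (F ∩ D)) = (E ∩ C) ∪ (F ∩ D) :=
      Subtype.ext (Set.inter_eq_right.2
        (Set.union_subset_union Set.inter_subset_left Set.inter_subset_left))
    have h2 : (E ∪ F) \ ((E ∩ C) ∪ (F ∩ D)) = (E \ C) ∪ (F \ D) := by
      apply Subtype.ext
      ext x
      have hx : x ∈ (E : Set X) → x ∉ (F : Set X) := fun a b => Set.disjoint_left.1 h a b
      change (x ∈ (E : Set X) ∨ x ∈ (F : Set X)) ∧ ¬ ((x ∈ (E : Set X) ∧ x ∈ (C : Set X)) ∨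
          (x ∈ (F : Set X) ∧ x ∈ (D : Set X))) ↔
        (x ∈ (E : Set X) ∧ x ∉ (C : Set X)) ∨ (x ∈ (F : Set X) ∧ x ∉ (D : Set X))
      tauto
    rw [h1, h2, ba_union μ _ _ (h.mono Set.inter_subset_left Set.inter_subset_left),
      ba_union ν _ _ (h.mono Set.sdiff_subset Set.sdiff_subset)]
    ring
  · refine le_ciInf fun C => ?_
    have h1 : (E ∪ F) ∩ C = (E ∩ C) ∪ (F ∩ C) := Subtype.ext (Set.union_inter_distrib_right _ _ _)
    have h2 : (E ∪ F) \ C = (E \ C) ∪ (F \ C) := Subtype.ext Set.union_sdiff_distrib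
    rw [h1, h2, ba_union μ _ _ (h.mono Set.inter_subset_left Set.inter_subset_left),
      ba_union ν _ _ (h.mono Set.sdiff_subset Set.sdiff_subset)]
    have := infFun_le μ ν E C
    have := infFun_le μ ν F C
    linarith
  · obtain ⟨K, hK⟩ := μ.2.2.2
    obtain ⟨L, hL⟩ := ν.2.2.2
    have key : ∀ E C : Meas X, |μ.1 (E ∩ C) + ν.1 (E \ C)| ≤ K + L := fun E C =>
      (abs_add_le _ _).trans (add_le_add (hK _) (hL _))
    refine ⟨K + L, fun E => abs_le.2 ⟨le_ciInf fun C => (abs_le.1 (key E C)).1, ?_⟩⟩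
    exact (infFun_le μ ν E ∅).trans (abs_le.1 (key E ∅)).2

/-- The vector lattice `ba(X, Σ)`; the supremum is `μ ∨ ν = -((-μ) ∧ (-ν))`. -/
instance instLatticeBa : Lattice (ba X) :=
  { (inferInstance : PartialOrder (ba X)) with
    inf := fun μ ν => ⟨infFun μ ν, infFun_mem μ ν⟩
    sup := fun μ ν => -⟨infFun (-μ) (-ν), infFun_mem (-μ) (-ν)⟩
    inf_le_left := fun μ ν E => by
      have h1 : E ∩ E = E := Subtype.ext (Set.inter_self _)
      have h2 : E \ E = (∅ : Meas X) := Subtype.ext (Set.sdiff_self)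
      have := infFun_le μ ν E E
      rw [h1, h2, ν.2.1, add_zero] at this
      exact this
    inf_le_right := fun μ ν E => by
      have h1 : E ∩ ∅ = (∅ : Meas X) := Subtype.ext (Set.inter_empty _)
      have h2 : E \ ∅ = E := Subtype.ext Set.sdiff_empty
      have := infFun_le μ ν E ∅
      rw [h1, h2, μ.2.1, zero_add] at this
      exact this
    le_inf := fun κ μ ν h1 h2 E => le_ciInf fun C => by
      rw [← ba_inter_add_diff κ E C]
      exact add_le_add (h1 _) (h2 _)
    le_sup_left := fun μ ν E => by
      have h1 : E ∩ E = E := Subtype.ext (Set.inter_self _)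
      have h2 : E \ E = (∅ : Meas X) := Subtype.ext (Set.sdiff_self)
      have := infFun_le (-μ) (-ν) E E
      rw [h1, h2, (-ν).2.1, add_zero] at this
      exact le_neg.1 this
    le_sup_right := fun μ ν E => by
      have h1 : E ∩ ∅ = (∅ : Meas X) := Subtype.ext (Set.inter_empty _)
      have h2 : E \ ∅ = E := Subtype.ext Set.sdiff_empty
      have := infFun_le (-μ) (-ν) E ∅
      rw [h1, h2, (-μ).2.1, zero_add] at this
      exact le_neg.1 this
    sup_le := fun μ ν κ h1 h2 E => by
      refine neg_le.1 (le_ciInf fun C => ?_)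
      rw [← ba_inter_add_diff κ E C, neg_add]
      exact add_le_add (neg_le_neg (h1 _)) (neg_le_neg (h2 _)) }

/-! ### Countably additive, purely finitely additive and probability measures -/

/-- `μ` is countably additive on `Σ`. -/
def IsCountablyAdditive (μ : ba X) : Prop :=
  ∀ E : ℕ → Meas X, Pairwise (fun i j => Disjoint (E i : Set X) (E j : Set X)) →
    HasSum (fun n => μ.1 (E n)) (μ.1 ⟨⋃ n, (E n : Set X), MeasurableSet.iUnion fun n => (E n).2⟩)

/-- Pure finite additivity of a non-negative measure `μ`: the only countably additive `ν` with
`0 ≤ ν ≤ μ` is zero. -/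
def IsPurelyFinAddNonneg (μ : ba X) : Prop :=
  ∀ ν : ba X, IsCountablyAdditive ν → 0 ≤ ν → ν ≤ μ → ν = 0

/-- A signed measure is purely finitely additive if both parts of its Jordan decomposition are. -/
def IsPurelyFinAdd (μ : ba X) : Prop :=
  IsPurelyFinAddNonneg (μ ⊔ 0) ∧ IsPurelyFinAddNonneg ((-μ) ⊔ 0)

/-- The set `S_ba` of finitely additive probability measures: `μ ≥ 0` and `‖μ‖ = μ(X) = 1`. -/
def Sba (X : Type*) [MeasurableSpace X] : Set (ba X) :=
  {μ | 0 ≤ μ ∧ μ.1 ⟨Set.univ, MeasurableSet.univ⟩ = 1}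

/-- Discreteness of `x` as an element of a vector sublattice `M` of a vector lattice `L`:
there are no disjoint `y > 0` and `z > 0` in `M` with `y ≤ |x|` and `z ≤ |x|`. -/
def IsDiscreteIn {L : Type*} [Lattice L] [AddCommGroup L] [Module ℝ L] (M : Submodule ℝ L)
    (x : L) : Prop :=
  ¬ ∃ y ∈ M, ∃ z ∈ M, 0 < y ∧ 0 < z ∧ y ⊓ z = 0 ∧ y ≤ |x| ∧ z ≤ |x|

/-! ### The integral with respect to a finitely additive measure -/

/-- The integral of a simple function. -/
def simpleIntegral (μ : ba X) (g : SimpleFunc X ℝ) : ℝ :=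
  ∑ c ∈ g.range, c * μ.1 ⟨g ⁻¹' {c}, g.measurableSet_fiber c⟩

/-- `I` is the integral of `f` against `μ`: the integrals of simple functions tend to `I` as the
simple functions tend to `f` uniformly. -/
def HasIntegral (μ : ba X) (f : X → ℝ) (I : ℝ) : Prop :=
  ∀ ε > 0, ∃ δ > 0, ∀ g : SimpleFunc X ℝ, (∀ x, |f x - g x| ≤ δ) → |simpleIntegral μ g - I| ≤ ε

open Classical in
/-- The integral `∫ f dμ` of a bounded measurable function `f` (for such `f` it exists and is
unique, see `hasIntegral_faIntegral` and `HasIntegral.unique`). -/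
def faIntegral (μ : ba X) (f : X → ℝ) : ℝ :=
  if h : ∃ I, HasIntegral μ f I then h.choose else 0

open Classical in
/-- Auxiliary extension of `μ` to all sets, with values in the operators on `ℝ`. -/
def toOp (μ : ba X) (s : Set X) : ℝ →L[ℝ] ℝ :=
  if h : MeasurableSet s then μ.1 ⟨s, h⟩ • ContinuousLinearMap.id ℝ ℝ else 0

theorem toOp_finMeasAdditive (μ : ba X) : FinMeasAdditive (0 : Measure X) (toOp μ) := by
  intro s t hs ht _ _ hst
  have h := ba_union μ ⟨s, hs⟩ ⟨t, ht⟩ hst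
  have h' : μ.1 ⟨s ∪ t, hs.union ht⟩ = μ.1 ⟨s, hs⟩ + μ.1 ⟨t, ht⟩ := h
  simp only [toOp, hs, ht, hs.union ht, dif_pos, h', add_smul]

theorem simpleIntegral_eq (μ : ba X) (g : SimpleFunc X ℝ) :
    simpleIntegral μ g = SimpleFunc.setToSimpleFunc (toOp μ) g := by
  refine Finset.sum_congr rfl fun c _ => ?_
  simp [toOp, g.measurableSet_fiber c, mul_comm]

theorem integrable_zero_measure (g : SimpleFunc X ℝ) : Integrable g (0 : Measure X) :=
  MeasureTheory.integrable_zero_measure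

theorem simpleIntegral_add (μ : ba X) (g h : SimpleFunc X ℝ) :
    simpleIntegral μ (g + h) = simpleIntegral μ g + simpleIntegral μ h := by
  simp only [simpleIntegral_eq]
  exact SimpleFunc.setToSimpleFunc_add _ (toOp_finMeasAdditive μ) (integrable_zero_measure g)
    (integrable_zero_measure h)

theorem simpleIntegral_sub (μ : ba X) (g h : SimpleFunc X ℝ) :
    simpleIntegral μ (g - h) = simpleIntegral μ g - simpleIntegral μ h := by
  simp only [simpleIntegral_eq]
  exact SimpleFunc.setToSimpleFunc_sub _ (toOp_finMeasAdditive μ) (integrable_zero_measure g)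
    (integrable_zero_measure h)

theorem simpleIntegral_add_left (μ ν : ba X) (g : SimpleFunc X ℝ) :
    simpleIntegral (μ + ν) g = simpleIntegral μ g + simpleIntegral ν g := by
  simp only [simpleIntegral, ← Finset.sum_add_distrib]
  exact Finset.sum_congr rfl fun c _ => mul_add _ _ _

theorem simpleIntegral_smul_left (a : ℝ) (μ : ba X) (g : SimpleFunc X ℝ) :
    simpleIntegral (a • μ) g = a * simpleIntegral μ g := by
  simp only [simpleIntegral, Finset.mul_sum]
  refine Finset.sum_congr rfl fun c _ => ?_
  change c * (a * _) = _
  ring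

theorem sum_fiber (μ : ba X) (g : SimpleFunc X ℝ) (S : Finset ℝ) :
    ∑ c ∈ S, μ.1 ⟨g ⁻¹' {c}, g.measurableSet_fiber c⟩ =
      μ.1 ⟨g ⁻¹' (S : Set ℝ), g.measurableSet_preimage _⟩ := by
  classical
  induction S using Finset.induction_on with
  | empty =>
    rw [Finset.sum_empty, ← μ.2.1]
    exact congrArg μ.1 (Subtype.ext (by simp))
  | insert a S ha ih =>
    rw [Finset.sum_insert ha, ih, ← ba_union μ]
    · refine congrArg μ.1 (Subtype.ext (Set.ext fun x => ?_))
      change (g x = a ∨ g x ∈ S) ↔ g x ∈ insert a S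
      rw [Finset.mem_insert]
    · rw [Set.disjoint_left]
      rintro x hx hx'
      have hx1 : g x = a := hx
      have hx2 : g x ∈ S := hx'
      exact ha (hx1 ▸ hx2)

theorem sum_abs_fiber_le (μ : ba X) {K : ℝ} (hK : ∀ E, |μ.1 E| ≤ K) (g : SimpleFunc X ℝ)
    (S : Finset ℝ) : ∑ c ∈ S, |μ.1 ⟨g ⁻¹' {c}, g.measurableSet_fiber c⟩| ≤ 2 * K := by
  classical
  rw [← Finset.sum_filter_add_sum_filter_not S
    (fun c => 0 ≤ μ.1 ⟨g ⁻¹' {c}, g.measurableSet_fiber c⟩)]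
  have h1 := (abs_le.1 (hK ⟨g ⁻¹' ((S.filter
    (fun c => 0 ≤ μ.1 ⟨g ⁻¹' {c}, g.measurableSet_fiber c⟩) : Finset ℝ) : Set ℝ),
      g.measurableSet_preimage _⟩)).2
  have h2 := (abs_le.1 (hK ⟨g ⁻¹' ((S.filter
    (fun c => ¬ 0 ≤ μ.1 ⟨g ⁻¹' {c}, g.measurableSet_fiber c⟩) : Finset ℝ) : Set ℝ),
      g.measurableSet_preimage _⟩)).1
  rw [← sum_fiber] at h1 h2
  rw [Finset.sum_congr rfl fun c hc => abs_of_nonneg (Finset.mem_filter.1 hc).2,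
    Finset.sum_congr rfl fun c hc => abs_of_neg (not_le.1 (Finset.mem_filter.1 hc).2),
    Finset.sum_neg_distrib]
  linarith

/-- The integrals of simple functions bounded by `r` are bounded by a multiple of `r`. -/
theorem exists_simpleIntegral_bound (μ : ba X) :
    ∃ K : ℝ, 0 < K ∧ ∀ (g : SimpleFunc X ℝ) (r : ℝ), 0 ≤ r → (∀ x, |g x| ≤ r) →
      |simpleIntegral μ g| ≤ K * r := by
  classical
  obtain ⟨K, hK⟩ := μ.2.2.2
  have hK0 : 0 ≤ K := (abs_nonneg _).trans (hK ∅)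
  refine ⟨2 * K + 1, by linarith, fun g r hr hg => ?_⟩
  have h1 : |simpleIntegral μ g| ≤
      ∑ c ∈ g.range, r * |μ.1 ⟨g ⁻¹' {c}, g.measurableSet_fiber c⟩| := by
    refine (Finset.abs_sum_le_sum_abs _ _).trans (Finset.sum_le_sum fun c hc => ?_)
    obtain ⟨x, rfl⟩ := SimpleFunc.mem_range.1 hc
    rw [abs_mul]
    exact mul_le_mul_of_nonneg_right (hg x) (abs_nonneg _)
  rw [← Finset.mul_sum] at h1
  have h2 := mul_le_mul_of_nonneg_left (sum_abs_fiber_le μ hK g g.range) hr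
  nlinarith

theorem exists_simpleFunc_approx {f : X → ℝ} (hf : Measurable f) {r : ℝ} (hr : ∀ x, |f x| ≤ r)
    {ε : ℝ} (hε : 0 < ε) : ∃ g : SimpleFunc X ℝ, ∀ x, |f x - g x| ≤ ε := by
  have hm : Measurable fun x => ⌊f x / ε⌋ := (hf.div_const ε).floor
  have hfin : (Set.range fun x => ⌊f x / ε⌋).Finite := by
    refine (Set.finite_Icc ⌊-r / ε⌋ ⌊r / ε⌋).subset ?_
    rintro _ ⟨x, rfl⟩
    have := abs_le.1 (hr x)
    exact ⟨Int.floor_mono (div_le_div_of_nonneg_right this.1 hε.le),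
      Int.floor_mono (div_le_div_of_nonneg_right this.2 hε.le)⟩
  let k : SimpleFunc X ℤ := ⟨fun x => ⌊f x / ε⌋, fun n => hm (measurableSet_singleton n), hfin⟩
  refine ⟨k.map fun n : ℤ => (n : ℝ) * ε, fun x => ?_⟩
  change |f x - (⌊f x / ε⌋ : ℝ) * ε| ≤ ε
  have h1 := Int.floor_le (f x / ε)
  have h2 := (Int.lt_floor_add_one (f x / ε)).le
  rw [le_div_iff₀ hε] at h1
  rw [div_le_iff₀ hε] at h2
  rw [abs_le]
  constructor <;> linarith

theorem HasIntegral.unique {μ : ba X} {f : X → ℝ} (hf : Measurable f) {r : ℝ}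
    (hr : ∀ x, |f x| ≤ r) {I J : ℝ} (hI : HasIntegral μ f I) (hJ : HasIntegral μ f J) : I = J := by
  refine eq_of_abs_sub_le_all fun ε hε => ?_
  obtain ⟨δ, hδ, h⟩ := hI (ε / 2) (half_pos hε)
  obtain ⟨δ', hδ', h'⟩ := hJ (ε / 2) (half_pos hε)
  obtain ⟨g, hg⟩ := exists_simpleFunc_approx hf hr (lt_min hδ hδ')
  have h1 := abs_le.1 (h g fun x => (hg x).trans (min_le_left _ _))
  have h2 := abs_le.1 (h' g fun x => (hg x).trans (min_le_right _ _))
  rw [abs_le]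
  constructor <;> linarith [h1.1, h1.2, h2.1, h2.2]

theorem exists_hasIntegral (μ : ba X) {f : X → ℝ} (hf : Measurable f) {r : ℝ}
    (hr : ∀ x, |f x| ≤ r) : ∃ I, HasIntegral μ f I := by
  obtain ⟨K, hK, hb⟩ := exists_simpleIntegral_bound μ
  have key : ∀ (g h : SimpleFunc X ℝ) (a b : ℝ), 0 ≤ a → 0 ≤ b → (∀ x, |f x - g x| ≤ a) →
      (∀ x, |f x - h x| ≤ b) → |simpleIntegral μ g - simpleIntegral μ h| ≤ K * (a + b) := by
    intro g h a b ha hb' hg hh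
    rw [← simpleIntegral_sub]
    refine hb _ _ (add_nonneg ha hb') fun x => ?_
    have h1 := abs_le.1 (hg x)
    have h2 := abs_le.1 (hh x)
    rw [SimpleFunc.coe_sub, Pi.sub_apply, abs_le]
    constructor <;> linarith [h1.1, h1.2, h2.1, h2.2]
  have hpos : ∀ n : ℕ, (0 : ℝ) < 1 / ((n : ℝ) + 1) := fun n => Nat.one_div_pos_of_nat
  choose s hs using fun n : ℕ => exists_simpleFunc_approx hf hr (hpos n)
  have hlim : Filter.Tendsto (fun n : ℕ => K * (1 / ((n : ℝ) + 1) + 1 / ((n : ℝ) + 1)))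
      Filter.atTop (nhds 0) := by
    have h := tendsto_one_div_add_atTop_nhds_zero_nat (𝕜 := ℝ)
    simpa using (h.add h).const_mul K
  have hc : CauchySeq fun n => simpleIntegral μ (s n) := by
    refine cauchySeq_of_le_tendsto_0 _ (fun n m N hn hm => ?_) hlim
    rw [Real.dist_eq]
    have hmono : ∀ {n : ℕ}, N ≤ n → (1 : ℝ) / ((n : ℝ) + 1) ≤ 1 / ((N : ℝ) + 1) := fun hn =>
      Nat.one_div_le_one_div hn
    exact key _ _ _ _ (hpos N).le (hpos N).le (fun x => (hs n x).trans (hmono hn))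
      (fun x => (hs m x).trans (hmono hm))
  obtain ⟨I, hI⟩ := cauchySeq_tendsto_of_complete hc
  refine ⟨I, fun ε hε => ⟨ε / K, div_pos hε hK, fun g hg => ?_⟩⟩
  have h1 : Filter.Tendsto (fun n => |simpleIntegral μ g - simpleIntegral μ (s n)|) Filter.atTop
      (nhds |simpleIntegral μ g - I|) := (tendsto_const_nhds.sub hI).abs
  have h2 : Filter.Tendsto (fun n : ℕ => K * (ε / K + 1 / ((n : ℝ) + 1))) Filter.atTop
      (nhds ε) := by
    have h := ((tendsto_one_div_add_atTop_nhds_zero_nat (𝕜 := ℝ)).const_add (ε / K)).const_mul K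
    rwa [add_zero, mul_div_cancel₀ _ hK.ne'] at h
  exact le_of_tendsto_of_tendsto' h1 h2 fun n =>
    key _ _ _ _ (div_pos hε hK).le (hpos n).le hg (hs n)

theorem hasIntegral_faIntegral (μ : ba X) {f : X → ℝ} (hf : Measurable f) {r : ℝ}
    (hr : ∀ x, |f x| ≤ r) : HasIntegral μ f (faIntegral μ f) := by
  have h := exists_hasIntegral μ hf hr
  rw [faIntegral, dif_pos h]
  exact h.choose_spec

theorem HasIntegral.faIntegral_eq {μ : ba X} {f : X → ℝ} (hf : Measurable f) {r : ℝ}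
    (hr : ∀ x, |f x| ≤ r) {I : ℝ} (h : HasIntegral μ f I) : faIntegral μ f = I :=
  (hasIntegral_faIntegral μ hf hr).unique hf hr h

theorem HasIntegral.add_left {μ ν : ba X} {f : X → ℝ} {I J : ℝ} (hI : HasIntegral μ f I)
    (hJ : HasIntegral ν f J) : HasIntegral (μ + ν) f (I + J) := by
  intro ε hε
  obtain ⟨δ, hδ, h⟩ := hI (ε / 2) (half_pos hε)
  obtain ⟨δ', hδ', h'⟩ := hJ (ε / 2) (half_pos hε)
  refine ⟨min δ δ', lt_min hδ hδ', fun g hg => ?_⟩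
  have h1 := abs_le.1 (h g fun x => (hg x).trans (min_le_left _ _))
  have h2 := abs_le.1 (h' g fun x => (hg x).trans (min_le_right _ _))
  rw [simpleIntegral_add_left, abs_le]
  constructor <;> linarith [h1.1, h1.2, h2.1, h2.2]

theorem HasIntegral.smul_left {μ : ba X} {f : X → ℝ} {I : ℝ} (a : ℝ) (hI : HasIntegral μ f I) :
    HasIntegral (a • μ) f (a * I) := by
  intro ε hε
  have ha : 0 < |a| + 1 := by positivity
  obtain ⟨δ, hδ, h⟩ := hI (ε / (|a| + 1)) (div_pos hε ha)
  refine ⟨δ, hδ, fun g hg => ?_⟩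
  rw [simpleIntegral_smul_left, ← mul_sub, abs_mul]
  calc |a| * |simpleIntegral μ g - I| ≤ (|a| + 1) * (ε / (|a| + 1)) :=
        mul_le_mul (by linarith) (h g hg) (abs_nonneg _) ha.le
    _ = ε := mul_div_cancel₀ _ ha.ne'

theorem faIntegral_add {μ : ba X} {f f' : X → ℝ} (hf : Measurable f) (hf' : Measurable f')
    {r r' : ℝ} (hr : ∀ x, |f x| ≤ r) (hr' : ∀ x, |f' x| ≤ r') :
    faIntegral μ (f + f') = faIntegral μ f + faIntegral μ f' := by
  have hs : ∀ x, |(f + f') x| ≤ r + r' := fun x =>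
    (abs_add_le _ _).trans (add_le_add (hr x) (hr' x))
  refine eq_of_abs_sub_le_all fun ε hε => ?_
  have h3 : (0 : ℝ) < ε / 3 := by positivity
  obtain ⟨δ, hδ, h⟩ := hasIntegral_faIntegral μ hf hr _ h3
  obtain ⟨δ', hδ', h'⟩ := hasIntegral_faIntegral μ hf' hr' _ h3
  obtain ⟨d, hd, hh⟩ := hasIntegral_faIntegral μ (hf.add hf') hs _ h3
  obtain ⟨g, hg⟩ := exists_simpleFunc_approx hf hr (lt_min hδ (half_pos hd))
  obtain ⟨g', hg'⟩ := exists_simpleFunc_approx hf' hr' (lt_min hδ' (half_pos hd))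
  have h1 := abs_le.1 (h g fun x => (hg x).trans (min_le_left _ _))
  have h2 := abs_le.1 (h' g' fun x => (hg' x).trans (min_le_left _ _))
  have h4 : |simpleIntegral μ (g + g') - faIntegral μ (f + f')| ≤ ε / 3 := by
    refine hh (g + g') fun x => ?_
    have a := abs_le.1 ((hg x).trans (min_le_right _ _))
    have b := abs_le.1 ((hg' x).trans (min_le_right _ _))
    rw [SimpleFunc.coe_add, Pi.add_apply, Pi.add_apply, abs_le]
    constructor <;> linarith [a.1, a.2, b.1, b.2]
  rw [simpleIntegral_add] at h4
  have h5 := abs_le.1 h4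
  rw [abs_le]
  constructor <;> linarith [h1.1, h1.2, h2.1, h2.2, h5.1, h5.2]

/-! ### The Markov operator and its invariant measures -/

/-- The transition probability `p(x, E)` as a real function of `x`. -/
def transProb (p : Kernel X X) (E : Meas X) (x : X) : ℝ := (p x).real (E : Set X)

theorem measurable_trans (p : Kernel X X) (E : Meas X) : Measurable (transProb p E) :=
  (p.measurable_coe E.2).ennreal_toReal

theorem abs_trans_le (p : Kernel X X) [IsMarkovKernel p] (E : Meas X) (x : X) :
    |transProb p E x| ≤ 1 := by
  rw [transProb, abs_of_nonneg measureReal_nonneg]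
  exact measureReal_le_one

theorem markov_mem (p : Kernel X X) [IsMarkovKernel p] (μ : ba X) :
    (fun E : Meas X => faIntegral μ (transProb p E)) ∈ ba X := by
  have hadd : ∀ E F : Meas X, Disjoint (E : Set X) (F : Set X) →
      faIntegral μ (transProb p (E ∪ F)) = faIntegral μ (transProb p E) + faIntegral μ (transProb p F) := by
    intro E F h
    rw [← faIntegral_add (measurable_trans p E) (measurable_trans p F) (abs_trans_le p E)
      (abs_trans_le p F)]
    congr 1
    funext x
    exact measureReal_union h F.2
  refine ⟨?_, hadd, ?_⟩
  · have h := hadd ∅ ∅ (Set.disjoint_empty _)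
    have h1 : (∅ : Meas X) ∪ ∅ = ∅ := Subtype.ext (Set.union_self _)
    rw [h1] at h
    linarith
  · obtain ⟨K, hK, hb⟩ := exists_simpleIntegral_bound μ
    refine ⟨2 * K + 1, fun E => ?_⟩
    obtain ⟨δ, hδ, h⟩ := hasIntegral_faIntegral μ (measurable_trans p E) (abs_trans_le p E) 1
      one_pos
    obtain ⟨g, hg⟩ := exists_simpleFunc_approx (measurable_trans p E) (abs_trans_le p E)
      (lt_min hδ one_pos)
    have h1 := abs_le.1 (h g fun x => (hg x).trans (min_le_left _ _))
    have h2 := abs_le.1 (hb g 2 (by norm_num) fun x => by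
      have a := abs_le.1 ((hg x).trans (min_le_right _ _))
      have b := abs_le.1 (abs_trans_le p E x)
      rw [abs_le]
      constructor <;> linarith [a.1, a.2, b.1, b.2])
    rw [abs_le]
    constructor <;> linarith [h1.1, h1.2, h2.1, h2.2]

/-- The Markov operator `A` on `ba(X, Σ)` of the chain with transition function `p`:
`(Aμ)(E) = ∫ p(x, E) μ(dx)`. -/
def markovOp (p : Kernel X X) [IsMarkovKernel p] : ba X →ₗ[ℝ] ba X where
  toFun μ := ⟨fun E => faIntegral μ (transProb p E), markov_mem p μ⟩
  map_add' μ ν := Subtype.ext <| funext fun E =>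
    ((hasIntegral_faIntegral μ (measurable_trans p E) (abs_trans_le p E)).add_left
      (hasIntegral_faIntegral ν (measurable_trans p E) (abs_trans_le p E))).faIntegral_eq
        (measurable_trans p E) (abs_trans_le p E)
  map_smul' a μ := Subtype.ext <| funext fun E =>
    ((hasIntegral_faIntegral μ (measurable_trans p E) (abs_trans_le p E)).smul_left a).faIntegral_eq
        (measurable_trans p E) (abs_trans_le p E)

/-- The space `M_ba` of all invariant bounded finitely additive measures, `Aμ = μ`. -/
def Mba (p : Kernel X X) [IsMarkovKernel p] : Submodule ℝ (ba X) where
  carrier := {μ | markovOp p μ = μ}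
  zero_mem' := map_zero _
  add_mem' := fun {μ ν} (hμ : _ = _) (hν : _ = _) => by
    change markovOp p (μ + ν) = μ + ν
    rw [map_add, hμ, hν]
  smul_mem' := fun a μ (hμ : _ = _) => by
    change markovOp p (a • μ) = a • μ
    rw [map_smul, hμ]

end FAMarkov

end

/-! The operator `A` is positive and preserves total mass, and mass is strictly positive: a
non-negative finitely additive measure with `μ(X) = 0` vanishes. Hence `μ ≤ Aμ` or `Aμ ≤ μ` already
forces `Aμ = μ`. Applied to suprema and infima of invariant measures, this makes `M_ba` a sublattice
(`sup_mem_Mba`, `inf_mem_Mba`).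

The rest of the structure is vector lattice theory (`exists_discrete_basis`). Disjoint positive
elements are linearly independent, so finite dimension allows a disjoint family with the most
members. Its members are discrete, since splitting one would give a larger family. It spans:
removing from `z ≥ 0` the largest multiple of each member leaves a remainder disjoint from all of
them, hence zero. By disjointness, a combination is non-negative exactly when its coefficients are,
so coordinates carry the order and with it the lattice operations.

For the type of a basis measure `μ`, let `κ` be its largest countably additive minorant. `Aκ` is
again countably additive and below `Aμ = μ`, so `Aκ ≤ κ` and `κ` is invariant. Discreteness makes
`κ` a multiple of `μ`: either `κ = 0` and `μ` is purely finitely additive, or `μ` is countably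
additive. -/

noncomputable section

namespace FAMarkov

open MeasureTheory ProbabilityTheory

/-! ### Disjointness in vector lattices -/

section VectorLattice

variable {L : Type*} [Lattice L] [AddCommGroup L]

theorem inf_eq_zero_of_le {x y a : L} (hy : 0 ≤ y) (hyx : y ≤ x) (ha : 0 ≤ a) (h : x ⊓ a = 0) :
    y ⊓ a = 0 :=
  le_antisymm (h ▸ inf_le_inf_right a hyx) (le_inf hy ha)

section DisjointFamily

variable [Module ℝ L] {M : Submodule ℝ L}

/-- A disjoint family of positive elements of `M`. -/
structure IsDisjointFamily (M : Submodule ℝ L) {k : ℕ} (f : Fin k → L) : Prop where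
  mem : ∀ i, f i ∈ M
  pos : ∀ i, 0 < f i
  disjoint : ∀ i j, i ≠ j → f i ⊓ f j = 0

theorem IsDisjointFamily.cons {k : ℕ} {f : Fin k → L} (hf : IsDisjointFamily M f) {w : L}
    (hw : w ∈ M) (hw0 : 0 < w) (hd : ∀ i, w ⊓ f i = 0) :
    IsDisjointFamily M (Fin.cons w f : Fin (k + 1) → L) where
  mem := Fin.cases (by simpa using hw) (by simpa using hf.mem)
  pos := Fin.cases (by simpa using hw0) (by simpa using hf.pos)
  disjoint i j := by
    refine Fin.cases ?_ (fun i => ?_) i <;> refine Fin.cases ?_ (fun j => ?_) j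
    · simp
    · intro _
      simpa using hd j
    · intro _
      simpa [inf_comm] using hd i
    · intro h
      simpa using hf.disjoint i j fun h' => h (congrArg _ h')

/-- Together with `cons`, this splits one member of a family into two disjoint pieces. -/
theorem IsDisjointFamily.update {k : ℕ} {f : Fin k → L} (hf : IsDisjointFamily M f) (i : Fin k)
    {w : L} (hw : w ∈ M) (hw0 : 0 < w) (hd : ∀ j, j ≠ i → w ⊓ f j = 0) :
    IsDisjointFamily M (Function.update f i w) where
  mem j := by
    rcases eq_or_ne j i with rfl | h
    · simpa using hw
    · simpa [h] using hf.mem j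
  pos j := by
    rcases eq_or_ne j i with rfl | h
    · simpa using hw0
    · simpa [h] using hf.pos j
  disjoint j l hjl := by
    rcases eq_or_ne j i with rfl | h
    · simpa [hjl.symm] using hd l hjl.symm
    rcases eq_or_ne l i with rfl | h'
    · simpa [h, inf_comm] using hd j h
    · simpa [h, h'] using hf.disjoint j l hjl

end DisjointFamily

/-- With `r = max c 1`, both `x ≤ r • x` and `c • a ≤ r • a`, so scaling the meet by `r⁻¹` puts it
below `x ⊓ a`. -/
theorem inf_smul_eq_zero [Module ℝ L] [PosSMulMono ℝ L] [SMulPosMono ℝ L] {x a : L}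
    (hx : 0 ≤ x) (ha : 0 ≤ a) (h : x ⊓ a = 0) {c : ℝ} (hc : 0 ≤ c) :
    x ⊓ c • a = 0 := by
  refine le_antisymm ?_ (le_inf hx (smul_nonneg hc ha))
  have hr : 0 < max c 1 := lt_max_of_lt_right one_pos
  have h1 : (max c 1)⁻¹ • (x ⊓ c • a) ≤ 0 := by
    rw [← h]
    refine le_inf ?_ ?_
    · rw [inv_smul_le_iff_of_pos hr]
      calc x ⊓ c • a ≤ (1 : ℝ) • x := by rw [one_smul]; exact inf_le_left
        _ ≤ max c 1 • x := smul_le_smul_of_nonneg_right (le_max_right _ _) hx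
    · rw [inv_smul_le_iff_of_pos hr]
      exact inf_le_right.trans (smul_le_smul_of_nonneg_right (le_max_left _ _) ha)
  rw [inv_smul_le_iff_of_pos hr, smul_zero] at h1
  exact h1

variable [IsOrderedAddMonoid L]

/-- Subtracting `a` from the meet gives an element below both `x` and `b`, hence below zero; so the
meet itself is below both `x` and `a`. -/
theorem inf_add_eq_zero {x a b : L} (hx : 0 ≤ x) (ha : 0 ≤ a) (hb : 0 ≤ b)
    (hxa : x ⊓ a = 0) (hxb : x ⊓ b = 0) : x ⊓ (a + b) = 0 := by
  refine le_antisymm ?_ (le_inf hx (add_nonneg ha hb))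
  have h1 : x ⊓ (a + b) - a ≤ 0 := by
    rw [← hxb]
    refine le_inf ?_ ?_
    · exact (sub_le_self _ ha).trans inf_le_left
    · rw [sub_le_iff_le_add']
      exact inf_le_right
  rw [← hxa]
  exact le_inf inf_le_left (sub_nonpos.1 h1)

theorem inf_sum_eq_zero {ι : Type*} {x : L} (hx : 0 ≤ x) (s : Finset ι) {f : ι → L}
    (hf : ∀ i ∈ s, 0 ≤ f i) (h : ∀ i ∈ s, x ⊓ f i = 0) : x ⊓ ∑ i ∈ s, f i = 0 := by
  classical
  induction s using Finset.induction_on with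
  | empty => simpa using hx
  | insert a s ha ih =>
    rw [Finset.sum_insert ha]
    exact inf_add_eq_zero hx (hf _ (Finset.mem_insert_self _ _))
      (Finset.sum_nonneg fun i hi => hf i (Finset.mem_insert_of_mem hi))
      (h _ (Finset.mem_insert_self _ _))
      (ih (fun i hi => hf i (Finset.mem_insert_of_mem hi))
        fun i hi => h i (Finset.mem_insert_of_mem hi))

variable [Module ℝ L] [PosSMulMono ℝ L] [SMulPosMono ℝ L]

/-- The coefficients of a non-negative combination of disjoint positive elements are
non-negative. -/
theorem coeff_nonneg_of_sum_nonneg {ι : Type*} [Fintype ι] {f : ι → L} (hf : ∀ i, 0 < f i)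
    (hd : ∀ i j, i ≠ j → f i ⊓ f j = 0) {a : ι → ℝ} (ha : 0 ≤ ∑ i, a i • f i) (j : ι) :
    0 ≤ a j := by
  classical
  by_contra! hj
  -- If `a j < 0`, then `(-a j) • f j` lies below the positive parts of the other terms while being
  -- disjoint from their sum, so it must vanish.
  have hP : f j ⊓ ∑ i ∈ Finset.univ.erase j, max (a i) 0 • f i = 0 :=
    inf_sum_eq_zero (hf j).le _ (fun i _ => smul_nonneg (le_max_right _ _) (hf i).le) fun i hi =>
      inf_smul_eq_zero (hf j).le (hf i).le (hd j i (Finset.ne_of_mem_erase hi).symm)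
        (le_max_right _ _)
  have hP0 : 0 ≤ ∑ i ∈ Finset.univ.erase j, max (a i) 0 • f i :=
    Finset.sum_nonneg fun i _ => smul_nonneg (le_max_right _ _) (hf i).le
  have h1 : (-a j) • f j ≤ ∑ i ∈ Finset.univ.erase j, max (a i) 0 • f i := by
    rw [← Finset.add_sum_erase _ _ (Finset.mem_univ j)] at ha
    rw [neg_smul, neg_le_iff_add_nonneg']
    exact ha.trans (add_le_add_right (Finset.sum_le_sum fun i _ =>
      smul_le_smul_of_nonneg_right (le_max_left _ _) (hf i).le) _)
  have h2 := inf_smul_eq_zero hP0 (hf j).le (by rw [inf_comm]; exact hP) (neg_pos.2 hj).le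
  rw [inf_eq_right.2 h1, smul_eq_zero_iff_right (neg_pos.2 hj).ne'] at h2
  exact (hf j).ne' h2

/-- In a vanishing combination both the sum and its negative are non-negative, so every coefficient
has both signs. -/
theorem linearIndependent_of_disjoint {ι : Type*} [Fintype ι] {f : ι → L} (hf : ∀ i, 0 < f i)
    (hd : ∀ i j, i ≠ j → f i ⊓ f j = 0) : LinearIndependent ℝ f := by
  rw [Fintype.linearIndependent_iff]
  intro a ha i
  refine le_antisymm ?_ (coeff_nonneg_of_sum_nonneg hf hd ha.ge i)
  have : 0 ≤ ∑ i, (-a i) • f i := by simp [neg_smul, ha]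
  have := coeff_nonneg_of_sum_nonneg hf hd this i
  linarith

/-! ### Discrete elements and finite-dimensional sublattices -/

variable {M : Submodule ℝ L}

/-- In the presence of a strictly positive functional, a positive element below a discrete
element is a multiple of it. -/
theorem IsDiscreteIn.eq_smul (hM : ∀ x ∈ M, x ⊔ 0 ∈ M) {φ : L →ₗ[ℝ] ℝ}
    (hφ : ∀ x, 0 < x → 0 < φ x) {x y : L} (hxd : IsDiscreteIn M x) (hxM : x ∈ M) (hx : 0 < x)
    (hyM : y ∈ M) (hy : 0 ≤ y) (hyx : y ≤ x) : y = (φ y / φ x) • x := by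
  have hφx := hφ x hx
  have hmono : ∀ {u v : L}, u ≤ v → φ u ≤ φ v := fun {u v} huv => by
    rcases huv.eq_or_lt with rfl | h
    · exact le_rfl
    · have := hφ _ (sub_pos.2 h)
      rw [map_sub] at this
      linarith
  have h0 : 0 ≤ φ y := by simpa using hmono hy
  have hc0 : 0 ≤ φ y / φ x := div_nonneg h0 hφx.le
  have hc1 : φ y / φ x ≤ 1 := (div_le_one hφx).2 (hmono hyx)
  have hcφ : φ ((φ y / φ x) • x) = φ y := by
    rw [map_smul, smul_eq_mul, div_mul_cancel₀ _ hφx.ne']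
  -- The constant makes `φ` vanish on `w = y - c • x`. If `w ≠ 0`, strict positivity of `φ` forbids
  -- `w` to have a sign, so its positive and negative parts are both nonzero; they are disjoint and,
  -- as `0 ≤ c ≤ 1`, lie below `x`, against discreteness.
  generalize φ y / φ x = c at *
  have hwM : y - c • x ∈ M := M.sub_mem hyM (M.smul_mem _ hxM)
  have hcx0 : 0 ≤ c • x := smul_nonneg hc0 hx.le
  have hcx : c • x ≤ x := by
    simpa using smul_le_smul_of_nonneg_right hc1 hx.le
  have hφw : φ (y - c • x) = 0 := by rw [map_sub, hcφ, sub_self]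
  have heq : ∀ w : L, φ w = 0 → 0 ≤ w → w = 0 := fun w hw h =>
    (h.eq_or_lt.resolve_right fun h' => (hφ w h').ne' hw).symm
  have hdisj : ((y - c • x) ⊔ 0) ⊓ (-(y - c • x) ⊔ 0) = 0 :=
    posPart_inf_negPart_eq_zero (y - c • x)
  have habs : |x| = x := abs_of_nonneg hx.le
  rw [← sub_eq_zero]
  by_contra hne
  have hne1 : (y - c • x) ⊔ 0 ≠ 0 := fun h => by
    have h' : 0 ≤ -(y - c • x) := neg_nonneg.2 (sup_eq_right.1 h)
    exact hne (neg_eq_zero.1 (heq _ (by rw [map_neg, hφw, neg_zero]) h'))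
  have hne2 : -(y - c • x) ⊔ 0 ≠ 0 := fun h =>
    hne (heq _ hφw (neg_nonpos.1 (sup_eq_right.1 h)))
  refine hxd ⟨_, hM _ hwM, _, hM _ (M.neg_mem hwM), lt_of_le_of_ne le_sup_right hne1.symm,
    lt_of_le_of_ne le_sup_right hne2.symm, hdisj, ?_, ?_⟩
  · rw [habs]
    exact sup_le ((sub_le_self _ hcx0).trans hyx) hx.le
  · rw [habs, neg_sub]
    exact sup_le ((sub_le_self _ hy).trans hcx) hx.le

theorem IsDisjointFamily.card_le [FiniteDimensional ℝ M] {k : ℕ} {f : Fin k → L}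
    (hf : IsDisjointFamily M f) : k ≤ Module.finrank ℝ M := by
  have h := linearIndependent_of_disjoint hf.pos hf.disjoint
  have h' : LinearIndependent ℝ (fun i => (⟨f i, hf.mem i⟩ : M)) :=
    LinearIndependent.of_comp M.subtype h
  simpa using h'.fintype_card_le_finrank

/-- Maximality is in the number of members, not under inclusion: splitting a member produces a
larger family that does not contain the old one. The dimension bounds this number. -/
theorem exists_maximal_disjointFamily (M : Submodule ℝ L) [FiniteDimensional ℝ M] :
    ∃ (k : ℕ) (f : Fin k → L), IsDisjointFamily M f ∧
      ∀ g : Fin (k + 1) → L, ¬ IsDisjointFamily M g := by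
  classical
  let P : ℕ → Prop := fun k => ∃ f : Fin k → L, IsDisjointFamily M f
  have hP0 : P 0 := ⟨Fin.elim0, fun i => i.elim0, fun i => i.elim0, fun i => i.elim0⟩
  obtain ⟨f, hf⟩ : P (Nat.findGreatest P (Module.finrank ℝ M)) :=
    Nat.findGreatest_spec (Nat.zero_le _) hP0
  exact ⟨_, f, hf, fun g hg =>
    Nat.findGreatest_is_greatest (Nat.lt_succ_self _) hg.card_le ⟨g, hg⟩⟩

/-- A finite-dimensional sublattice of a vector lattice with a strictly positive functional is
spanned by finitely many pairwise disjoint normalised discrete elements. -/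
theorem exists_discrete_basis (M : Submodule ℝ L) [FiniteDimensional ℝ M]
    (hM : ∀ x ∈ M, x ⊔ 0 ∈ M) (hinf : ∀ x ∈ M, ∀ y ∈ M, x ⊓ y ∈ M) {φ : L →ₗ[ℝ] ℝ}
    (hφ : ∀ x, 0 < x → 0 < φ x) :
    ∃ (k : ℕ) (b : Fin k → L), (∀ i, 0 < b i ∧ φ (b i) = 1 ∧ IsDiscreteIn M (b i)) ∧
      (∀ i j, i ≠ j → b i ⊓ b j = 0) ∧ Submodule.span ℝ (Set.range b) = M := by
  obtain ⟨k, f, hf, hmax⟩ := exists_maximal_disjointFamily M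
  obtain ⟨b, hb, hbφ⟩ : ∃ b : Fin k → L, IsDisjointFamily M b ∧ ∀ i, φ (b i) = 1 := by
    have hinv : ∀ i, 0 < (φ (f i))⁻¹ := fun i => inv_pos.2 (hφ _ (hf.pos i))
    have hb0 : ∀ i, 0 ≤ (φ (f i))⁻¹ • f i := fun i => smul_nonneg (hinv i).le (hf.pos i).le
    refine ⟨fun i => (φ (f i))⁻¹ • f i, ⟨fun i => M.smul_mem _ (hf.mem i), fun i =>
      lt_of_le_of_ne (hb0 i) (smul_ne_zero (hinv i).ne' (hf.pos i).ne').symm,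
      fun i j hij => ?_⟩, fun i => ?_⟩
    · refine inf_smul_eq_zero (hb0 i) (hf.pos j).le ?_ (hinv j).le
      rw [inf_comm]
      exact inf_smul_eq_zero (hf.pos j).le (hf.pos i).le (hf.disjoint j i hij.symm) (hinv i).le
    · rw [map_smul, smul_eq_mul, inv_mul_cancel₀ (hφ _ (hf.pos i)).ne']
  have hdisc : ∀ i, IsDiscreteIn M (b i) := by
    rintro i ⟨y, hyM, z, hzM, hy, hz, hyz, hyb, hzb⟩
    rw [abs_of_nonneg (hb.pos i).le] at hyb hzb
    have hd : ∀ w, 0 < w → w ≤ b i → ∀ j, j ≠ i → w ⊓ b j = 0 := fun w hw hwb j hj =>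
      inf_eq_zero_of_le hw.le hwb (hb.pos j).le (hb.disjoint i j hj.symm)
    -- Replacing `b i` by `z` and prepending `y` gives `k + 1` disjoint elements.
    refine hmax _ ((hb.update i hzM hz (hd z hz hzb)).cons hyM hy fun j => ?_)
    rcases eq_or_ne j i with rfl | hj
    · simpa using hyz
    · simpa [hj] using hd y hy hyb j hj
  refine ⟨k, b, fun i => ⟨hb.pos i, hbφ i, hdisc i⟩, hb.disjoint, le_antisymm ?_ ?_⟩
  · rw [Submodule.span_le]
    rintro _ ⟨i, rfl⟩
    exact hb.mem i
  have hmem : ∀ i, b i ∈ Submodule.span ℝ (Set.range b) := fun i =>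
    Submodule.subset_span ⟨i, rfl⟩
  have key : ∀ z ∈ M, 0 ≤ z → z ∈ Submodule.span ℝ (Set.range b) := by
    intro z hzM hz
    have hφz : 0 ≤ φ z := by
      rcases hz.eq_or_lt with rfl | h
      · simp
      · exact (hφ z h).le
    -- Every multiple `s • b i ≤ z` has `s ≤ φ z < t`, so meeting `t⁻¹ • z` with `b i` loses none of
    -- them. The summand `1` keeps `t` positive when `z = 0`.
    set t : ℝ := φ z + 1 with ht
    have ht0 : 0 < t := by linarith
    have hsmul : ∀ i y, y ∈ M → 0 ≤ y → y ≤ b i → y = φ y • b i := fun i y hyM hy hyb => by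
      simpa [hbφ i] using (hdisc i).eq_smul hM hφ (hb.mem i) (hb.pos i) hyM hy hyb
    have hex : ∀ i, ∃ c : ℝ, 0 ≤ c ∧ c • b i ≤ z ∧ (z - c • b i) ⊓ b i = 0 := by
      intro i
      have hti : 0 ≤ t⁻¹ • z ⊓ b i := le_inf (smul_nonneg (inv_pos.2 ht0).le hz) (hb.pos i).le
      have hdi := hsmul i _ (hinf _ (M.smul_mem _ hzM) _ (hb.mem i)) hti inf_le_right
      set d := φ (t⁻¹ • z ⊓ b i)
      have hd0 : 0 ≤ d := by
        rcases hti.eq_or_lt with h | h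
        · simp [d, ← h]
        · exact (hφ _ h).le
      have hle : (t * d) • b i ≤ z := by
        rw [mul_smul, ← hdi, ← le_inv_smul_iff_of_pos ht0]
        exact inf_le_left
      have h0 : 0 ≤ (z - (t * d) • b i) ⊓ b i := le_inf (sub_nonneg.2 hle) (hb.pos i).le
      refine ⟨t * d, mul_nonneg ht0.le hd0, hle, ?_⟩
      have hei := hsmul i _ (hinf _ (M.sub_mem hzM (M.smul_mem (t * d) (hb.mem i))) _ (hb.mem i))
        h0 inf_le_right
      set e := φ ((z - (t * d) • b i) ⊓ b i)
      -- A remainder still meeting `b i` in `e • b i` with `e > 0` would give `(t * d + e) • b i ≤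
      -- z`, hence `(d + e / t) • b i ≤ t⁻¹ • z ⊓ b i = d • b i`, which is impossible.
      by_contra hne
      have hepos : 0 < e := hφ _ (lt_of_le_of_ne h0 (Ne.symm hne))
      have hsum : (t * d + e) • b i ≤ z := by
        rw [add_smul, ← hei, ← le_sub_iff_add_le']
        exact inf_le_left
      have hφmono : t * d + e ≤ φ z := by
        rcases hsum.eq_or_lt with h | h
        · rw [← h, map_smul, hbφ, smul_eq_mul, mul_one]
        · have := hφ _ (sub_pos.2 h)
          rw [map_sub, map_smul, hbφ, smul_eq_mul, mul_one] at this
          linarith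
      have hd1 : d + e / t ≤ 1 := by
        rw [← mul_le_mul_iff_right₀ ht0, mul_add, mul_div_cancel₀ _ ht0.ne']
        linarith
      have hle2 : (d + e / t) • b i ≤ d • b i := by
        rw [← hdi]
        refine le_inf ?_ ?_
        · rw [le_inv_smul_iff_of_pos ht0, smul_smul, mul_add, mul_div_cancel₀ _ ht0.ne']
          exact hsum
        · simpa using smul_le_smul_of_nonneg_right hd1 (hb.pos i).le
      have hneg : (e / t) • b i ≤ 0 := by
        rw [add_smul] at hle2
        exact (add_le_iff_nonpos_right _).1 hle2
      have hpos : 0 ≤ (e / t) • b i := smul_nonneg (div_pos hepos ht0).le (hb.pos i).le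
      exact smul_ne_zero (div_pos hepos ht0).ne' (hb.pos i).ne' (le_antisymm hneg hpos)
    choose c hc0 hcz hcd using hex
    have hcb : ∀ i, 0 ≤ c i • b i := fun i => smul_nonneg (hc0 i) (hb.pos i).le
    -- A sum of disjoint positive elements is their supremum, so bounding each term by `z` suffices.
    have hsum : ∀ s : Finset (Fin k), ∑ i ∈ s, c i • b i ≤ z := by
      intro s
      induction s using Finset.induction_on with
      | empty => simpa using hz
      | insert a s ha ih =>
        have hdis : c a • b a ⊓ ∑ i ∈ s, c i • b i = 0 := by
          refine inf_sum_eq_zero (hcb a) s (fun i _ => hcb i) fun i hi => ?_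
          refine inf_smul_eq_zero (hcb a) (hb.pos i).le ?_ (hc0 i)
          rw [inf_comm]
          refine inf_smul_eq_zero (hb.pos i).le (hb.pos a).le (hb.disjoint i a ?_) (hc0 a)
          rintro rfl
          exact ha hi
        rw [Finset.sum_insert ha, ← inf_add_sup (c a • b a), hdis, zero_add]
        exact sup_le (hcz a) ih
    have hw0 : 0 ≤ z - ∑ i, c i • b i := sub_nonneg.2 (hsum _)
    have hwM : z - ∑ i, c i • b i ∈ M :=
      M.sub_mem hzM (M.sum_mem fun i _ => M.smul_mem _ (hb.mem i))
    -- The remainder is below each `z - c i • b i`, hence disjoint from every `b i`; if nonzero it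
    -- could be adjoined to the family.
    have hw : z - ∑ i, c i • b i = 0 := by
      by_contra hne
      refine hmax _ (hb.cons hwM (lt_of_le_of_ne hw0 (Ne.symm hne)) fun i => ?_)
      refine inf_eq_zero_of_le hw0 (sub_le_sub_left ?_ z) (hb.pos i).le (hcd i)
      exact Finset.single_le_sum (f := fun i => c i • b i) (fun i _ => hcb i) (Finset.mem_univ i)
    rw [sub_eq_zero.1 hw]
    exact Submodule.sum_mem _ fun i _ => Submodule.smul_mem _ _ (hmem i)
  intro z hz
  have h : z = (z ⊔ 0) - (-z ⊔ 0) := (posPart_sub_negPart z).symm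
  rw [h]
  exact Submodule.sub_mem _ (key _ (hM _ hz) le_sup_right)
    (key _ (hM _ (M.neg_mem hz)) le_sup_right)

end VectorLattice

/-! ### Positivity, mass and the sublattice of invariant measures -/

variable {X : Type*} [MeasurableSpace X]

instance : IsOrderedAddMonoid (ba X) where
  add_le_add_left _ _ h κ E := add_le_add_left (h E) (κ.1 E)

instance : PosSMulMono ℝ (ba X) where
  smul_le_smul_of_nonneg_left _ ha _ _ h E := mul_le_mul_of_nonneg_left (h E) ha

instance : SMulPosMono ℝ (ba X) where
  smul_le_smul_of_nonneg_right _ hμ _ _ h E := mul_le_mul_of_nonneg_right h (hμ E)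

/-- The total mass `μ ↦ μ(X)`. -/
def mass : ba X →ₗ[ℝ] ℝ where
  toFun μ := μ.1 ⟨Set.univ, MeasurableSet.univ⟩
  map_add' _ _ := rfl
  map_smul' _ _ := rfl

theorem le_mass {μ : ba X} (hμ : 0 ≤ μ) (E : Meas X) : μ.1 E ≤ mass μ := by
  change _ ≤ μ.1 ⟨Set.univ, MeasurableSet.univ⟩
  rw [← ba_inter_add_diff μ ⟨Set.univ, MeasurableSet.univ⟩ E]
  have h : (⟨Set.univ, MeasurableSet.univ⟩ : Meas X) ∩ E = E := Subtype.ext (Set.univ_inter _)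
  rw [h]
  exact le_add_of_nonneg_right (hμ _)

theorem eq_zero_of_mass_eq_zero {μ : ba X} (hμ : 0 ≤ μ) (h : mass μ = 0) : μ = 0 :=
  le_antisymm (fun E => (le_mass hμ E).trans h.le) hμ

/-- This makes `mass` the strictly positive functional `φ` required by the lattice results. -/
theorem mass_pos (μ : ba X) (hμ : 0 < μ) : 0 < mass μ :=
  lt_of_le_of_ne (hμ.le _) fun h => hμ.ne' (eq_zero_of_mass_eq_zero hμ.le h.symm)

theorem sum_range_fiber (μ : ba X) (g : SimpleFunc X ℝ) :
    ∑ c ∈ g.range, μ.1 ⟨g ⁻¹' {c}, g.measurableSet_fiber c⟩ = mass μ := by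
  rw [sum_fiber]
  exact congrArg μ.1 (Subtype.ext (by ext x; simp))

theorem markovOp_nonneg (p : Kernel X X) [IsMarkovKernel p] {μ : ba X} (hμ : 0 ≤ μ) :
    0 ≤ markovOp p μ := by
  intro E
  change 0 ≤ faIntegral μ (transProb p E)
  refine le_of_forall_pos_le_add fun ε hε => ?_
  have hm : 0 ≤ mass μ := hμ _
  obtain ⟨δ, hδ, h⟩ := hasIntegral_faIntegral μ (measurable_trans p E) (abs_trans_le p E) _
    (half_pos hε)
  -- A simple approximant of a non-negative function may dip below zero by this tolerance, which
  -- costs at most `ε / 2` after integration; the `+ 1` covers `mass μ = 0`.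
  have hη : 0 < ε / (2 * (mass μ + 1)) := by positivity
  obtain ⟨g, hg⟩ := exists_simpleFunc_approx (measurable_trans p E) (abs_trans_le p E)
    (lt_min hδ hη)
  have h1 := abs_le.1 (h g fun x => (hg x).trans (min_le_left _ _))
  have h2 : -(ε / (2 * (mass μ + 1))) * mass μ ≤ simpleIntegral μ g := by
    rw [← sum_range_fiber μ g, Finset.mul_sum, sum_range_fiber]
    refine Finset.sum_le_sum fun c hc => mul_le_mul_of_nonneg_right ?_ (hμ _)
    obtain ⟨x, rfl⟩ := SimpleFunc.mem_range.1 hc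
    have h3 := (abs_le.1 ((hg x).trans (min_le_right _ _))).2
    have h4 : 0 ≤ transProb p E x := measureReal_nonneg
    linarith
  have h5 : ε / (2 * (mass μ + 1)) * mass μ ≤ ε / 2 := by
    rw [div_mul_eq_mul_div, div_le_iff₀ (by positivity)]
    nlinarith
  linarith [h1.2]

/-- Since `p(x, X) = 1` for all `x`, the constant simple function `1` approximates the integrand
with no error. -/
theorem mass_markovOp (p : Kernel X X) [IsMarkovKernel p] (μ : ba X) :
    mass (markovOp p μ) = mass μ := by
  change faIntegral μ (transProb p ⟨Set.univ, MeasurableSet.univ⟩) = mass μ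
  refine eq_of_abs_sub_le_all fun ε hε => ?_
  obtain ⟨δ, hδ, h⟩ := hasIntegral_faIntegral μ (measurable_trans p ⟨Set.univ, MeasurableSet.univ⟩)
    (abs_trans_le p _) ε hε
  have h1 := h (SimpleFunc.const X 1) fun x => by simp [transProb, hδ.le]
  have h2 : simpleIntegral μ (SimpleFunc.const X 1) = mass μ := by
    rw [← sum_range_fiber μ (SimpleFunc.const X 1)]
    refine Finset.sum_congr rfl fun c hc => ?_
    obtain ⟨x, rfl⟩ := SimpleFunc.mem_range.1 hc
    exact one_mul _
  rwa [h2, abs_sub_comm] at h1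

theorem markovOp_mono (p : Kernel X X) [IsMarkovKernel p] {μ ν : ba X} (h : μ ≤ ν) :
    markovOp p μ ≤ markovOp p ν := by
  have := markovOp_nonneg p (sub_nonneg.2 h)
  rwa [map_sub, sub_nonneg] at this

/-- A measure comparable with its image is invariant. -/
theorem mem_Mba_of_le (p : Kernel X X) [IsMarkovKernel p] {μ : ba X} (h : μ ≤ markovOp p μ) :
    μ ∈ Mba p :=
  sub_eq_zero.1 (eq_zero_of_mass_eq_zero (sub_nonneg.2 h)
    (by rw [map_sub, mass_markovOp, sub_self]))

theorem mem_Mba_of_ge (p : Kernel X X) [IsMarkovKernel p] {μ : ba X} (h : markovOp p μ ≤ μ) :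
    μ ∈ Mba p :=
  (sub_eq_zero.1 (eq_zero_of_mass_eq_zero (sub_nonneg.2 h)
    (by rw [map_sub, mass_markovOp, sub_self]))).symm

theorem sup_mem_Mba {p : Kernel X X} [IsMarkovKernel p] {μ ν : ba X} (hμ : μ ∈ Mba p)
    (hν : ν ∈ Mba p) : μ ⊔ ν ∈ Mba p := by
  refine mem_Mba_of_le p (sup_le ?_ ?_)
  · calc μ = markovOp p μ := Eq.symm hμ
      _ ≤ _ := markovOp_mono p le_sup_left
  · calc ν = markovOp p ν := Eq.symm hν
      _ ≤ _ := markovOp_mono p le_sup_right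

theorem inf_mem_Mba {p : Kernel X X} [IsMarkovKernel p] {μ ν : ba X} (hμ : μ ∈ Mba p)
    (hν : ν ∈ Mba p) : μ ⊓ ν ∈ Mba p := by
  refine mem_Mba_of_ge p (le_inf ?_ ?_)
  · calc _ ≤ markovOp p μ := markovOp_mono p inf_le_left
      _ = μ := hμ
  · calc _ ≤ markovOp p ν := markovOp_mono p inf_le_right
      _ = ν := hν

/-! ### Countably additive minorants -/

/-- A finite measure as an element of `ba(X, Σ)`. -/
def ofMeasure (ν : Measure X) [IsFiniteMeasure ν] : ba X :=
  ⟨fun E => ν.real E, by simp, fun E F h => measureReal_union h F.2,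
    ν.real Set.univ, fun E => by
      rw [abs_of_nonneg measureReal_nonneg]
      exact measureReal_mono (Set.subset_univ _)⟩

theorem isCountablyAdditive_ofMeasure (ν : Measure X) [IsFiniteMeasure ν] :
    IsCountablyAdditive (ofMeasure ν) := by
  intro E hE
  change HasSum (fun n => (ν (E n)).toReal) (ν (⋃ n, (E n : Set X))).toReal
  have h := measure_iUnion (μ := ν) hE fun n => (E n).2
  have hne : ∑' n, ν (E n) ≠ ⊤ := h ▸ measure_ne_top ν _
  rw [h, ENNReal.tsum_toReal_eq fun n => measure_ne_top ν _]
  exact (ENNReal.summable_toReal hne).hasSum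

theorem IsCountablyAdditive.smul {μ : ba X} (hμ : IsCountablyAdditive μ) (c : ℝ) :
    IsCountablyAdditive (c • μ) := fun E hE => (hμ E hE).mul_left c

theorem IsCountablyAdditive.exists_measure {μ : ba X} (hμ : IsCountablyAdditive μ) (h0 : 0 ≤ μ) :
    ∃ ν : Measure X, ∀ E : Meas X, ν E = ENNReal.ofReal (μ.1 E) := by
  refine ⟨Measure.ofMeasurable (fun s hs => ENNReal.ofReal (μ.1 ⟨s, hs⟩)) ?_ ?_, fun E =>
    Measure.ofMeasurable_apply _ E.2⟩
  · exact (congrArg ENNReal.ofReal μ.2.1).trans ENNReal.ofReal_zero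
  · intro f hf hd
    have h := hμ (fun n => ⟨f n, hf n⟩) hd
    rw [← h.tsum_eq]
    exact ENNReal.ofReal_tsum_of_nonneg (fun n => h0 _) h.summable

theorem hasIntegral_ofMeasure (ν : Measure X) [IsFiniteMeasure ν] {f : X → ℝ} (hf : Measurable f)
    {r : ℝ} (hr : ∀ x, |f x| ≤ r) : HasIntegral (ofMeasure ν) f (∫ x, f x ∂ν) := by
  intro ε hε
  have hm : 0 ≤ ν.real Set.univ := measureReal_nonneg
  have hfi : Integrable f ν :=
    Integrable.of_bound hf.aestronglyMeasurable r (Filter.Eventually.of_forall hr)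
  refine ⟨ε / (ν.real Set.univ + 1), by positivity, fun g hg => ?_⟩
  have hgi : Integrable g ν := SimpleFunc.integrable_of_isFiniteMeasure g
  have h1 : simpleIntegral (ofMeasure ν) g = ∫ x, g x ∂ν := by
    rw [← SimpleFunc.integral_eq_integral _ hgi, SimpleFunc.integral_eq]
    exact Finset.sum_congr rfl fun c _ => mul_comm _ _
  rw [h1, ← integral_sub hgi hfi]
  have h2 := norm_integral_le_of_norm_le_const (μ := ν) (f := fun x => g x - f x)
    (Filter.Eventually.of_forall fun x => by rw [Real.norm_eq_abs, abs_sub_comm]; exact hg x)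
  rw [Real.norm_eq_abs] at h2
  refine h2.trans ?_
  rw [div_mul_eq_mul_div, div_le_iff₀ (by positivity)]
  nlinarith

/-- The operator thus preserves countable additivity, because on finite measures the finitely
additive integral is the Lebesgue integral. -/
theorem markovOp_ofMeasure (p : Kernel X X) [IsMarkovKernel p] (ν : Measure X)
    [IsFiniteMeasure ν] : markovOp p (ofMeasure ν) = ofMeasure (ν.bind p) := by
  refine Subtype.ext (funext fun E => ?_)
  change faIntegral (ofMeasure ν) (transProb p E) = (ν.bind p).real E
  rw [(hasIntegral_ofMeasure ν (measurable_trans p E) (abs_trans_le p E)).faIntegral_eq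
    (measurable_trans p E) (abs_trans_le p E), Measure.real, Measure.bind_apply E.2 p.aemeasurable]
  exact integral_toReal (p.measurable_coe E.2).aemeasurable
    (Filter.Eventually.of_forall fun x => measure_lt_top _ _)

/-- A non-negative finitely additive measure has a largest countably additive minorant. -/
theorem exists_largest_minorant {μ : ba X} (hμ : 0 ≤ μ) :
    ∃ κ : Measure X, (∀ E : Meas X, κ E ≤ ENNReal.ofReal (μ.1 E)) ∧
      ∀ ν : Measure X, (∀ E : Meas X, ν E ≤ ENNReal.ofReal (μ.1 E)) → ν ≤ κ := by
  classical
  -- The minorant is the outer measure generated by `μ` through countable covers; the value `⊤`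
  -- rules out non-measurable covering sets.
  let v : Set X → ENNReal := fun s =>
    if h : MeasurableSet s then ENNReal.ofReal (μ.1 ⟨s, h⟩) else ⊤
  have hv : ∀ E : Meas X, v E = ENNReal.ofReal (μ.1 E) := fun E => dif_pos E.2
  have hv0 : v ∅ = 0 := by
    have := hv ∅
    rw [μ.2.1, ENNReal.ofReal_zero] at this
    exact this
  have hle : ‹MeasurableSpace X› ≤ (OuterMeasure.ofFunction v hv0).caratheodory := by
    intro s hs
    refine OuterMeasure.ofFunction_caratheodory fun t => ?_
    by_cases ht : MeasurableSet t
    · have h1 := hv ((⟨t, ht⟩ : Meas X) ∩ ⟨s, hs⟩)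
      have h2 := hv ((⟨t, ht⟩ : Meas X) \ ⟨s, hs⟩)
      have h3 := hv ⟨t, ht⟩
      rw [← ba_inter_add_diff μ _ ⟨s, hs⟩, ENNReal.ofReal_add (hμ _) (hμ _), ← h1, ← h2] at h3
      exact h3.ge
    · have : v t = ⊤ := dif_neg ht
      rw [this]
      exact le_top
  refine ⟨(OuterMeasure.ofFunction v hv0).toMeasure hle, fun E => ?_, fun ν hν => ?_⟩
  · rw [toMeasure_apply _ _ E.2, ← hv]
    exact OuterMeasure.ofFunction_le _
  · refine Measure.le_iff.2 fun s hs => ?_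
    rw [toMeasure_apply _ _ hs]
    -- The generated outer measure is the largest one below `v`, which gives the maximality of `κ`.
    have : ν.toOuterMeasure ≤ OuterMeasure.ofFunction v hv0 := by
      refine OuterMeasure.le_ofFunction.2 fun t => ?_
      by_cases ht : MeasurableSet t
      · exact (hν ⟨t, ht⟩).trans (hv ⟨t, ht⟩).ge
      · have : v t = ⊤ := dif_neg ht
        rw [this]
        exact le_top
    exact this s

theorem isPurelyFinAdd_of_nonneg {μ : ba X} (hμ : 0 ≤ μ) (h : IsPurelyFinAddNonneg μ) :
    IsPurelyFinAdd μ := by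
  refine ⟨by rwa [sup_eq_left.2 hμ], ?_⟩
  rw [sup_eq_right.2 (neg_nonpos.2 hμ)]
  exact fun ν _ h0 h1 => le_antisymm h1 h0

/-- A discrete invariant measure is countably additive or purely finitely additive. -/
theorem isCountablyAdditive_or_isPurelyFinAdd {p : Kernel X X} [IsMarkovKernel p] {μ : ba X}
    (hμ : μ ∈ Mba p) (h0 : 0 < μ) (hd : IsDiscreteIn (Mba p) μ) :
    IsCountablyAdditive μ ∨ IsPurelyFinAdd μ := by
  by_cases hp : IsPurelyFinAddNonneg μ
  · exact Or.inr (isPurelyFinAdd_of_nonneg h0.le hp)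
  left
  simp only [IsPurelyFinAddNonneg, not_forall] at hp
  obtain ⟨ν, hν, hν0, hνμ, hne⟩ := hp
  obtain ⟨κ, hκμ, hκ⟩ := exists_largest_minorant h0.le
  have hfin : IsFiniteMeasure κ :=
    ⟨(hκμ ⟨Set.univ, MeasurableSet.univ⟩).trans_lt ENNReal.ofReal_lt_top⟩
  have hle : ofMeasure κ ≤ μ := fun E => ENNReal.toReal_le_of_le_ofReal (h0.le E) (hκμ E)
  have hνκ : ν ≤ ofMeasure κ := by
    obtain ⟨ν', hν'⟩ := hν.exists_measure hν0
    have h := hκ ν' fun E => (hν' E).le.trans (ENNReal.ofReal_le_ofReal (hνμ E))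
    intro E
    change ν.1 E ≤ κ.real E
    rw [← ENNReal.toReal_ofReal (hν0 E)]
    exact ENNReal.toReal_mono (measure_ne_top κ _) ((hν' E).ge.trans (h E))
  -- The image of `κ` is a countably additive minorant of `Aμ = μ`, so it is below `κ` by
  -- maximality.
  have hmem : ofMeasure κ ∈ Mba p := by
    refine mem_Mba_of_ge p ?_
    have h1 : ofMeasure (κ.bind p) ≤ μ := by
      rw [← markovOp_ofMeasure]
      calc _ ≤ markovOp p μ := markovOp_mono p hle
        _ = μ := hμ
    have h2 : κ.bind p ≤ κ := hκ _ fun E =>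
      (ENNReal.le_ofReal_iff_toReal_le (measure_ne_top _ _) (h0.le E)).2 (h1 E)
    rw [markovOp_ofMeasure]
    exact fun E => ENNReal.toReal_mono (measure_ne_top κ _) (h2 E)
  have hpos : 0 < ofMeasure κ := (lt_of_le_of_ne hν0 (Ne.symm hne)).trans_le hνκ
  have heq := hd.eq_smul (fun x hx => sup_mem_Mba hx (Submodule.zero_mem _)) mass_pos hμ h0 hmem
    hpos.le hle
  -- As `κ` is this multiple of `μ`, a nonzero factor can be inverted to write `μ` as a multiple of
  -- `κ`.
  have hc : mass (ofMeasure κ) / mass μ ≠ 0 :=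
    (div_pos (mass_pos _ hpos) (mass_pos _ h0)).ne'
  rw [← inv_smul_smul₀ hc μ, ← heq]
  exact (isCountablyAdditive_ofMeasure κ).smul _

end FAMarkov

end
-- Coordinates in the disjoint basis
open FAMarkov in
theorem theorem3p3 {X : Type*} [MeasurableSpace X]
    (p : ProbabilityTheory.Kernel X X) [ProbabilityTheory.IsMarkovKernel p]
    (m : ℕ) (hm : Module.rank ℝ (Mba p) = m) :
    (∀ μ ∈ Mba p, ∀ ν ∈ Mba p, μ ⊔ ν ∈ Mba p ∧ μ ⊓ ν ∈ Mba p) ∧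
    (∃ Φ : Mba p ≃ₗ[ℝ] (Fin m → ℝ),
      (∀ μ ν : Mba p, μ ≤ ν ↔ Φ μ ≤ Φ ν) ∧
      (∀ μ ν σ : Mba p, (σ : ba X) = (μ : ba X) ⊔ (ν : ba X) → Φ σ = Φ μ ⊔ Φ ν) ∧
      (∀ μ ν σ : Mba p, (σ : ba X) = (μ : ba X) ⊓ (ν : ba X) → Φ σ = Φ μ ⊓ Φ ν)) ∧
    ∃ b : Fin m → ba X,
      LinearIndependent ℝ b ∧ Submodule.span ℝ (Set.range b) = Mba p ∧
      (∀ i, b i ∈ Sba X) ∧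
      (∀ i, IsDiscreteIn (Mba p) (b i)) ∧
      (∀ i, IsCountablyAdditive (b i) ∨ IsPurelyFinAdd (b i)) ∧
      (∀ i j, i ≠ j → b i ⊓ b j = 0) ∧
      (∀ μ ∈ Mba p, ∃! α : Fin m → ℝ, μ = ∑ i, α i • b i) := by
  have hfd : FiniteDimensional ℝ (Mba p) :=
    FiniteDimensional.of_rank_eq_nat hm
  obtain ⟨k, b, hb, hdisj, hspan⟩ := exists_discrete_basis (Mba p)
    (fun x hx => sup_mem_Mba hx (Submodule.zero_mem _)) (fun x hx y hy => inf_mem_Mba hx hy)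
    mass_pos
  have hli : LinearIndependent ℝ b := linearIndependent_of_disjoint (fun i => (hb i).1) hdisj
  have hk : k = m := by
    have h := finrank_span_eq_card hli
    rw [hspan, Module.finrank_eq_of_rank_eq hm, Fintype.card_fin] at h
    exact h.symm
  subst hk
  have hmem : ∀ i, b i ∈ Mba p := fun i => hspan ▸ Submodule.subset_span ⟨i, rfl⟩
  let B : Module.Basis (Fin k) ℝ (Mba p) :=
    (Module.Basis.span hli).map (LinearEquiv.ofEq _ _ hspan)
  have hB : ∀ i, (B i : ba X) = b i := fun i => by
    simp [B, Module.Basis.span_apply]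
  have hrepr : ∀ μ : Mba p, (μ : ba X) = ∑ i, B.equivFun μ i • b i := fun μ => by
    refine (congrArg (Mba p).subtype (B.sum_equivFun μ)).symm.trans ?_
    rw [map_sum]
    exact Finset.sum_congr rfl fun i _ => by rw [map_smul, Submodule.subtype_apply, hB]
  have hnonneg : ∀ μ : Mba p, 0 ≤ (μ : ba X) ↔ 0 ≤ B.equivFun μ := by
    intro μ
    constructor
    · intro h
      rw [hrepr μ] at h
      exact fun i => coeff_nonneg_of_sum_nonneg (fun i => (hb i).1) hdisj h i
    · intro h
      rw [hrepr μ]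
      exact Finset.sum_nonneg fun i _ => smul_nonneg (h i) (hb i).1.le
  have hle : ∀ μ ν : Mba p, (μ : ba X) ≤ ν ↔ B.equivFun μ ≤ B.equivFun ν := by
    intro μ ν
    have h : B.equivFun (ν - μ) = B.equivFun ν - B.equivFun μ := map_sub B.equivFun ν μ
    rw [← sub_nonneg, ← Submodule.coe_sub, hnonneg, h, sub_nonneg]
  refine ⟨fun μ hμ ν hν => ⟨sup_mem_Mba hμ hν, inf_mem_Mba hμ hν⟩,
    ⟨B.equivFun, hle, fun μ ν σ hσ => ?_, fun μ ν σ hσ => ?_⟩,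
    b, hli, hspan, fun i => ⟨(hb i).1.le, (hb i).2.1⟩, fun i => (hb i).2.2,
    fun i => isCountablyAdditive_or_isPurelyFinAdd (hmem i) (hb i).1 (hb i).2.2, hdisj,
    fun μ hμ => ⟨B.equivFun ⟨μ, hμ⟩, hrepr ⟨μ, hμ⟩, fun α hα => ?_⟩⟩
  · refine le_antisymm ?_ (sup_le ((hle _ _).1 (hσ ▸ le_sup_left)) ((hle _ _).1 (hσ ▸ le_sup_right)))
    -- The coordinatewise supremum comes from some invariant measure; that measure is an upper bound
    -- of `μ` and `ν`, hence lies above their supremum `σ` in `ba X`.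
    rw [← B.equivFun.apply_symm_apply (B.equivFun μ ⊔ B.equivFun ν), ← hle, hσ]
    refine sup_le ((hle _ _).2 ?_) ((hle _ _).2 ?_) <;> rw [LinearEquiv.apply_symm_apply]
    exacts [le_sup_left, le_sup_right]
  · refine le_antisymm (le_inf ((hle _ _).1 (hσ ▸ inf_le_left)) ((hle _ _).1 (hσ ▸ inf_le_right))) ?_
    rw [← B.equivFun.apply_symm_apply (B.equivFun μ ⊓ B.equivFun ν), ← hle, hσ]
    refine le_inf ((hle _ _).2 ?_) ((hle _ _).2 ?_) <;> rw [LinearEquiv.apply_symm_apply]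
    exacts [inf_le_left, inf_le_right]
  · have h : (⟨μ, hμ⟩ : Mba p) = ∑ i, α i • B i := Subtype.ext (by simp [hB, hα])
    rw [h]
    exact (B.equivFun_symm_apply α ▸ B.equivFun.apply_symm_apply α).symm
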